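/- A finite group $G$ is called a Leinster group if the sum of the orders of its normal subgroups (including the trivial subgroup and $G$ itself) equals $2|G|$. Let $p$ and $q$ be primes (not necessarily distinct). If $G$ is a Leinster group of order $p^3q$, then $G \cong C_7 \rtimes C_8$, where $C_n$ denotes the cyclic group of order $n$ and $C_7 \rtimes C_8$ is the nonabelian semidirect product of order $56$ in which a generator of $C_8$ acts on $C_7$ by inversion, $x \mapsto x^{-1}$. -/

import Mathlib

/-- The sum `σ(G)` of the orders of the normal subgroups of a finite group `G`
(each normal subgroup, including the trivial one and `G` itself, counted once). -/
noncomputable def normalOrderSum (G : Type*) [Group G] [Finite G] : ℕ :=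
  ∑ᶠ N : {N : Subgroup G // N.Normal}, Nat.card N.1

/-- A finite group is a Leinster group if the sum of the orders of its normal subgroups equals
twice the order of the group. -/
def IsLeinster (G : Type*) [Group G] [Finite G] : Prop :=
  normalOrderSum G = 2 * Nat.card G

/-- The cyclic group `C_n` of order `n` (for `n ≥ 1`), written multiplicatively. -/
abbrev Cyc (n : ℕ) : Type := Multiplicative (ZMod n)

/-- The inversion action of `C_8` on `C_7`: a generator of `C_8` acts by `x ↦ x⁻¹`. It is the only
nontrivial homomorphism `C_8 → Aut(C_7)`, since `Aut(C_7)` is cyclic of order `6`. -/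
def inversionAction : Cyc 8 →* MulAut (Cyc 7) where
  toFun k := (MulEquiv.inv (Cyc 7) : MulAut (Cyc 7)) ^ (ZMod.val (Multiplicative.toAdd k))
  map_one' := by simp
  map_mul' a b := by
    have h : (MulEquiv.inv (Cyc 7) : MulAut (Cyc 7)) ^ 8 = 1 := by
      ext x
      simp [pow_succ]
    rw [toAdd_mul, ZMod.val_add, ← pow_add]
    exact (pow_eq_pow_mod _ h).symm

/-- The nonabelian semidirect product `C_7 ⋊ C_8`, of order `56`. -/
abbrev C7SemidirectC8 : Type := Cyc 7 ⋊[inversionAction] Cyc 8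

/-! Write σ for the sum of the orders of the normal subgroups. If every nontrivial normal subgroup
had order divisible by p, then σ(G) ≡ 1 mod p, contradicting σ(G) = 2|G|; so there is a normal Q of
prime order q ≠ p. Sorting normal subgroups by whether they contain Q gives qσ(G/Q) + S = 2p³q,
where S sums the orders of those avoiding Q, all p-groups (`normalOrderSum_eq_quotient_add`).

Modulo p this yields p ∣ q + 1. For odd p, a Sylow p-subgroup P then centralizes Q, so it is normal,
S = σ(G/Q), and (q + 1)σ(G/Q) = 2p³q is impossible (`mul_add_ne_of_modEq_one`).

For p = 2, S > 0 forces σ(G/Q) < 16, so G/Q is cyclic of order 8, σ(G/Q) = 15 and S = q. The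
subgroups of P = ⟨g⟩ form a chain, which leaves only q = 7 with g² centralizing Q and g inverting
it. -/

/-- The finite set of normal subgroups of a finite group. -/
noncomputable def normalSubgroups (G : Type*) [Group G] [Finite G] : Finset (Subgroup G) :=
  (Set.toFinite {N : Subgroup G | N.Normal}).toFinset

@[simp]
lemma mem_normalSubgroups {G : Type*} [Group G] [Finite G] {N : Subgroup G} :
    N ∈ normalSubgroups G ↔ N.Normal := by
  simp [normalSubgroups]

lemma normalOrderSum_eq_sum (G : Type*) [Group G] [Finite G] :
    normalOrderSum G = ∑ N ∈ normalSubgroups G, Nat.card N := by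
  rw [normalOrderSum, normalSubgroups, ← finsum_mem_eq_finite_toFinset_sum]
  exact finsum_set_coe_eq_finsum_mem (f := fun N : Subgroup G => Nat.card N)
    {N : Subgroup G | N.Normal}

lemma normalOrderSum_congr {G H : Type*} [Group G] [Finite G] [Group H] [Finite H]
    (e : G ≃* H) : normalOrderSum G = normalOrderSum H := by
  rw [normalOrderSum_eq_sum, normalOrderSum_eq_sum]
  refine Finset.sum_bij (fun N _ => N.map e.toMonoidHom) ?_ ?_ ?_ ?_
  · intro N hN
    rw [mem_normalSubgroups] at hN ⊢
    exact hN.map _ e.surjective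
  · intro N _ N' _ h
    exact Subgroup.map_injective (f := e.toMonoidHom) e.injective h
  · intro M hM
    rw [mem_normalSubgroups] at hM
    refine ⟨M.comap e.toMonoidHom, ?_, Subgroup.map_comap_eq_self_of_surjective e.surjective M⟩
    rw [mem_normalSubgroups]
    exact hM.comap _
  · intro N _
    exact (Subgroup.card_map_of_injective (f := e.toMonoidHom) e.injective).symm

/-- Among subgroups whose nontrivial members have order divisible by `p`, the sum of the orders
is `1` modulo `p`, provided the trivial subgroup is present. -/
lemma sum_card_modEq_one {G : Type*} [Group G] {p : ℕ} (s : Finset (Subgroup G))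
    (hbot : ⊥ ∈ s) (h : ∀ N ∈ s, N ≠ ⊥ → p ∣ Nat.card N) :
    ∑ N ∈ s, Nat.card N ≡ 1 [MOD p] := by
  classical
  rw [← Finset.add_sum_erase s _ hbot, Subgroup.card_bot]
  have : p ∣ ∑ N ∈ s.erase ⊥, Nat.card N :=
    Finset.dvd_sum fun N hN => h N (Finset.mem_of_mem_erase hN) (Finset.ne_of_mem_erase hN)
  simpa using (Nat.ModEq.refl 1).add ((Nat.modEq_zero_iff_dvd).2 this)

lemma Subgroup.dvd_card_of_card_dvd_prime_pow {G : Type*} [Group G] [Finite G] {p n : ℕ}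
    (hp : p.Prime) {N : Subgroup G} (hN : Nat.card N ∣ p ^ n) (hne : N ≠ ⊥) :
    p ∣ Nat.card N := by
  obtain ⟨k, -, hk⟩ := (Nat.dvd_prime_pow hp).1 hN
  rcases k with _ | k
  · exact absurd (Subgroup.card_eq_one.1 (by simpa using hk)) hne
  · rw [hk]; exact dvd_pow_self p k.succ_ne_zero

lemma normalOrderSum_modEq_one {G : Type*} [Group G] [Finite G] {p n : ℕ} (hp : p.Prime)
    (h : Nat.card G = p ^ n) : normalOrderSum G ≡ 1 [MOD p] := by
  rw [normalOrderSum_eq_sum]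
  exact sum_card_modEq_one _ (by simp only [mem_normalSubgroups]; infer_instance) fun N _ =>
    Subgroup.dvd_card_of_card_dvd_prime_pow hp (h ▸ Subgroup.card_subgroup_dvd_card N)

/-! ### Splitting the sum at a normal subgroup. -/

lemma Subgroup.card_comap_mk' {G : Type*} [Group G] (Q : Subgroup G) [Q.Normal]
    [Finite G] (M : Subgroup (G ⧸ Q)) :
    Nat.card (M.comap (QuotientGroup.mk' Q)) = Nat.card Q * Nat.card M := by
  have h1 := Subgroup.index_comap_of_surjective M (QuotientGroup.mk'_surjective Q)
  have h2 := Subgroup.card_mul_index (M.comap (QuotientGroup.mk' Q))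
  have h3 := Subgroup.card_mul_index M
  have h4 := Subgroup.card_mul_index Q
  rw [← Subgroup.index_eq_card, ← h3, ← h2, h1] at *
  have : M.index ≠ 0 := Subgroup.index_ne_zero_of_finite
  apply Nat.eq_of_mul_eq_mul_right (Nat.pos_of_ne_zero this)
  rw [← h4]; ring

/-- Sum of the orders of the normal subgroups not containing `Q`. -/
noncomputable def normalOrderSumAvoiding {G : Type*} [Group G] [Finite G] (Q : Subgroup G) : ℕ :=
  open Classical in ∑ N ∈ normalSubgroups G with ¬ Q ≤ N, Nat.card N

/-- By the correspondence theorem, normal subgroups above Q come from the quotient, with orders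
scaled by |Q|. -/
lemma normalOrderSum_eq_quotient_add {G : Type*} [Group G] [Finite G] (Q : Subgroup G)
    [Q.Normal] :
    normalOrderSum G = Nat.card Q * normalOrderSum (G ⧸ Q) + normalOrderSumAvoiding Q := by
  classical
  rw [normalOrderSum_eq_sum G, normalOrderSumAvoiding,
    ← Finset.sum_filter_add_sum_filter_not _ (fun N => Q ≤ N)]
  congr 1
  rw [normalOrderSum_eq_sum, Finset.mul_sum]
  symm
  refine Finset.sum_bij (fun M _ => M.comap (QuotientGroup.mk' Q)) ?_ ?_ ?_ ?_
  · intro M hM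
    rw [mem_normalSubgroups] at hM
    rw [Finset.mem_filter, mem_normalSubgroups]
    exact ⟨hM.comap _, QuotientGroup.le_comap_mk' Q M⟩
  · intro M _ M' _ h
    exact Subgroup.comap_injective (QuotientGroup.mk'_surjective Q) h
  · intro N hN
    rw [Finset.mem_filter, mem_normalSubgroups] at hN
    refine ⟨N.map (QuotientGroup.mk' Q), ?_, ?_⟩
    · rw [mem_normalSubgroups]
      exact hN.1.map _ (QuotientGroup.mk'_surjective Q)
    · rw [QuotientGroup.comap_map_mk']
      exact sup_eq_right.2 hN.2
  · intro M _
    exact (Subgroup.card_comap_mk' Q M).symm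

lemma Subgroup.le_or_disjoint_of_prime_card {G : Type*} [Group G] [Finite G] {Q : Subgroup G}
    (hQ : (Nat.card Q).Prime) (N : Subgroup G) : Q ≤ N ∨ Disjoint Q N := by
  rcases (Nat.dvd_prime hQ).1 (Subgroup.card_dvd_of_le (inf_le_left : Q ⊓ N ≤ Q)) with h | h
  · exact Or.inr (disjoint_iff.2 (Subgroup.card_eq_one.1 h))
  · exact Or.inl (inf_eq_left.1 (Subgroup.eq_of_le_of_card_ge inf_le_left h.ge))

lemma Subgroup.not_le_of_card_dvd_prime_pow {G : Type*} [Group G] {p n : ℕ}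
    {Q : Subgroup G} (hp : p.Prime) (hQ : (Nat.card Q).Prime)
    (hQp : Nat.card Q ≠ p) {N : Subgroup G} (h : Nat.card N ∣ p ^ n) : ¬ Q ≤ N := fun hle =>
  hQp ((Nat.prime_dvd_prime_iff_eq hQ hp).1
    (hQ.dvd_of_dvd_pow ((Subgroup.card_dvd_of_le hle).trans h)))

/-! ### Normal subgroups avoiding a subgroup of prime order. -/

section Split

variable {G : Type*} [Group G] {p n : ℕ} {Q P : Subgroup G}

/-- A subgroup is normal once it is normalized by `Q` (which centralizes it) and by a
complement `P`. -/
lemma normal_of_isComplement'_of_commute (hc : Q.IsComplement' P) {N : Subgroup G}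
    (hQ : ∀ x ∈ Q, ∀ y ∈ N, Commute x y) (hP : ∀ x ∈ P, ∀ y ∈ N, x * y * x⁻¹ ∈ N) :
    N.Normal := by
  refine ⟨fun y hy g => ?_⟩
  obtain ⟨⟨⟨a, ha⟩, ⟨b, hb⟩⟩, rfl⟩ := hc.2 g
  have h1 := hP b hb y hy
  have h2 := (hQ a ha _ h1).eq
  have : a * b * y * (a * b)⁻¹ = b * y * b⁻¹ := by
    calc _ = (a * (b * y * b⁻¹)) * a⁻¹ := by group
      _ = _ := by rw [h2]; group
  exact this ▸ h1

variable [Finite G]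

/-- N meets Q trivially, so |NQ| = |N||Q| divides pⁿ|Q|. -/
lemma card_dvd_of_not_le (hQ : (Nat.card Q).Prime)
    (hG : Nat.card G = p ^ n * Nat.card Q) {N : Subgroup G} (hN : N.Normal)
    (h : ¬ Q ≤ N) : Nat.card N ∣ p ^ n := by
  have hd := (Subgroup.le_or_disjoint_of_prime_card hQ N).resolve_left h
  have h1 : N.relIndex (N ⊔ Q) = Nat.card Q := by
    rw [Subgroup.relIndex_sup_left, ← Subgroup.inf_relIndex_right, hd.symm.eq_bot,
      Subgroup.relIndex_bot_left]
  have h2 := Subgroup.relIndex_mul_relIndex ⊥ N (N ⊔ Q) bot_le le_sup_left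
  rw [Subgroup.relIndex_bot_left, Subgroup.relIndex_bot_left] at h2
  have h3 := Subgroup.card_subgroup_dvd_card (N ⊔ Q)
  rw [← h2, h1, hG] at h3
  exact Nat.dvd_of_mul_dvd_mul_right hQ.pos h3

lemma normalOrderSumAvoiding_modEq_one (hp : p.Prime) (hQ : (Nat.card Q).Prime)
    (hG : Nat.card G = p ^ n * Nat.card Q) : normalOrderSumAvoiding Q ≡ 1 [MOD p] := by
  classical
  refine sum_card_modEq_one _ ?_ ?_
  · rw [Finset.mem_filter, mem_normalSubgroups, le_bot_iff, ← Subgroup.card_eq_one]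
    exact ⟨inferInstance, hQ.ne_one⟩
  · intro N hN
    rw [Finset.mem_filter, mem_normalSubgroups] at hN
    exact Subgroup.dvd_card_of_card_dvd_prime_pow hp (card_dvd_of_not_le hQ hG hN.1 hN.2)

/-- NP is a p-group, so its order divides pⁿ = |P| and NP = P. -/
lemma le_of_normal_of_card_dvd (hp : p.Prime) (hQ : (Nat.card Q).Prime) (hQp : Nat.card Q ≠ p)
    (hG : Nat.card G = p ^ n * Nat.card Q) (hP : Nat.card P = p ^ n) {N : Subgroup G}
    (hN : N.Normal) (h : Nat.card N ∣ p ^ n) : N ≤ P := by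
  have : Fact p.Prime := ⟨hp⟩
  have h1 : IsPGroup p N := isPGroup_iff_card_dvd_pow.2 ⟨n, h⟩
  have h2 : IsPGroup p P := IsPGroup.of_card hP
  obtain ⟨k, hk⟩ := (IsPGroup.iff_card.1 (IsPGroup.to_sup_of_normal_left h1 h2))
  have h3 : Nat.card (N ⊔ P : Subgroup G) ∣ p ^ n := by
    refine Nat.Coprime.dvd_of_dvd_mul_right (n := Nat.card Q) ?_
      (hG ▸ Subgroup.card_subgroup_dvd_card _)
    rw [hk]
    exact Nat.Coprime.pow_left _ ((Nat.coprime_primes hp hQ).2 hQp.symm)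
  have h4 : P = N ⊔ P := Subgroup.eq_of_le_of_card_ge le_sup_right
    (hP ▸ Nat.le_of_dvd (pow_pos hp.pos n) h3)
  rw [h4]; exact le_sup_left

lemma isComplement'_of_card_prime_pow (hp : p.Prime) (hQ : (Nat.card Q).Prime)
    (hQp : Nat.card Q ≠ p) (hG : Nat.card G = p ^ n * Nat.card Q) (hP : Nat.card P = p ^ n) :
    Q.IsComplement' P := by
  refine Subgroup.isComplement'_of_coprime (by rw [hP, hG, mul_comm]) ?_
  rw [hP]
  exact Nat.Coprime.pow_right _ ((Nat.coprime_primes hQ hp).2 hQp)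

/-- A complement of a normal subgroup is isomorphic to the quotient. -/
noncomputable def Subgroup.IsComplement'.mulEquivQuotient [Q.Normal] (hc : Q.IsComplement' P) :
    P ≃* G ⧸ Q :=
  MulEquiv.ofBijective ((QuotientGroup.mk' Q).comp P.subtype) <| by
    constructor
    · rw [injective_iff_map_eq_one]
      intro x hx
      have hx' : (x : G) ∈ Q := by simpa using hx
      exact Subtype.ext (Subgroup.disjoint_def.1 hc.disjoint hx' x.2)
    · intro y
      obtain ⟨g, rfl⟩ := QuotientGroup.mk_surjective y
      obtain ⟨⟨a, b⟩, rfl⟩ := hc.symm.2 g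
      refine ⟨a, ?_⟩
      simp

/-- If `Q` has a normal complement, then the normal subgroups avoiding `Q` correspond to those of
the complement. -/
lemma normalOrderSumAvoiding_eq_of_normal (hp : p.Prime) (hQ : (Nat.card Q).Prime)
    (hQp : Nat.card Q ≠ p) (hG : Nat.card G = p ^ n * Nat.card Q) (hP : Nat.card P = p ^ n)
    [Q.Normal] (hPn : P.Normal) :
    normalOrderSumAvoiding Q = normalOrderSum (G ⧸ Q) := by
  classical
  have hc := isComplement'_of_card_prime_pow hp hQ hQp hG hP
  rw [← normalOrderSum_congr hc.mulEquivQuotient, normalOrderSum_eq_sum, normalOrderSumAvoiding]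
  symm
  refine Finset.sum_bij (fun M _ => M.map P.subtype) ?_ ?_ ?_ ?_
  · intro M hM
    rw [mem_normalSubgroups] at hM
    rw [Finset.mem_filter, mem_normalSubgroups]
    refine ⟨normal_of_isComplement'_of_commute hc ?_ ?_,
      Subgroup.not_le_of_card_dvd_prime_pow hp hQ hQp (n := n) ?_⟩
    · intro x hx y hy
      exact Subgroup.commute_of_normal_of_disjoint Q P inferInstance hPn hc.disjoint x y hx
        (Subgroup.map_subtype_le M hy)
    · rintro x hx _ ⟨y, hy, rfl⟩
      exact ⟨⟨x, hx⟩ * y * ⟨x, hx⟩⁻¹, hM.conj_mem y hy _, by simp⟩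
    · rw [Subgroup.card_map_of_injective P.subtype_injective, ← hP]
      exact Subgroup.card_subgroup_dvd_card M
  · intro M _ M' _ h
    exact Subgroup.map_injective P.subtype_injective h
  · intro N hN
    rw [Finset.mem_filter, mem_normalSubgroups] at hN
    have hle := le_of_normal_of_card_dvd hp hQ hQp hG hP hN.1 (card_dvd_of_not_le hQ hG hN.1 hN.2)
    refine ⟨N.subgroupOf P, ?_, ?_⟩
    · rw [mem_normalSubgroups]
      exact hN.1.subgroupOf P
    · rw [Subgroup.subgroupOf_map_subtype, inf_eq_left.2 hle]
  · intro M _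
    exact (Subgroup.card_map_of_injective P.subtype_injective).symm

end Split

/-! ### Conjugation on a normal subgroup of prime order. -/

section Conj

variable {G : Type*} [Group G] {Q : Subgroup G}

lemma commute_of_conjNormal_eq_one [Q.Normal] {g : G}
    (h : (MulAut.conjNormal g : MulAut Q) = 1) {x : G} (hx : x ∈ Q) : Commute x g := by
  have h1 := congrArg Subtype.val (DFunLike.congr_fun h ⟨x, hx⟩)
  rw [MulAut.conjNormal_apply] at h1
  exact (mul_inv_eq_iff_eq_mul.1 h1).symm

lemma orderOf_conjNormal_dvd [Finite G] [Q.Normal] (hQ : (Nat.card Q).Prime) (g : G) :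
    orderOf (MulAut.conjNormal g : MulAut Q) ∣ Nat.card Q - 1 := by
  have : Fact (Nat.card Q).Prime := ⟨hQ⟩
  have : IsCyclic Q := isCyclic_of_prime_card rfl
  rw [← Nat.totient_prime hQ, ← IsCyclic.card_mulAut]
  exact orderOf_dvd_natCard _

lemma normal_of_isComplement'_of_forall_commute {P : Subgroup G} (hc : Q.IsComplement' P)
    (h : ∀ x ∈ Q, ∀ y ∈ P, Commute x y) : P.Normal :=
  normal_of_isComplement'_of_commute hc h fun _ hx _ hy =>
    P.mul_mem (P.mul_mem hx hy) (P.inv_mem hx)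

/-- An element whose square centralizes a normal subgroup of prime order either centralizes
or inverts it. -/
lemma forall_commute_or_forall_conj_eq_inv [Finite G] [Q.Normal] (hQ : (Nat.card Q).Prime)
    {g : G} (h : ∀ x ∈ Q, Commute x (g ^ 2)) :
    (∀ x ∈ Q, Commute x g) ∨ ∀ x ∈ Q, g * x * g⁻¹ = x⁻¹ := by
  have : Fact (Nat.card Q).Prime := ⟨hQ⟩
  have : IsCyclic Q := isCyclic_of_prime_card rfl
  rcases Subgroup.le_or_disjoint_of_prime_card hQ (Subgroup.centralizer {g}) with h1 | h1
  · left
    intro x hx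
    exact (Subgroup.mem_centralizer_singleton_iff.1 (h1 hx))
  · right
    intro x hx
    have hgx : g * x * g⁻¹ ∈ Q := Subgroup.Normal.conj_mem inferInstance x hx g
    have hcomm : x * (g * x * g⁻¹) = (g * x * g⁻¹) * x :=
      congrArg Subtype.val (mul_comm' (⟨x, hx⟩ : Q) ⟨_, hgx⟩)
    have h2 : g ^ 2 * x * (g ^ 2)⁻¹ = x := by rw [← (h x hx).eq]; group
    -- Since g² centralizes Q, conjugation by g swaps the two commuting factors; their product is
    -- thus fixed and lies in Q ∩ C(g) = 1.
    have h3 : x * (g * x * g⁻¹) = 1 := by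
      refine Subgroup.disjoint_def.1 h1 (Q.mul_mem hx hgx) ?_
      rw [Subgroup.mem_centralizer_singleton_iff]
      calc x * (g * x * g⁻¹) * g = g * x * g⁻¹ * x * g := by rw [hcomm]
        _ = g * x * g⁻¹ * (g ^ 2 * x * (g ^ 2)⁻¹) * g := by rw [h2]
        _ = g * (x * (g * x * g⁻¹)) := by group
    exact eq_inv_of_mul_eq_one_right h3

end Conj

lemma card_quotient_of_card_eq {G : Type*} [Group G] {p n : ℕ} {Q : Subgroup G}
    (hQ : (Nat.card Q).Prime) (hcard : Nat.card G = p ^ n * Nat.card Q) :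
    Nat.card (G ⧸ Q) = p ^ n := by
  have := Subgroup.card_eq_card_quotient_mul_card_subgroup Q
  exact Nat.eq_of_mul_eq_mul_right hQ.pos (this.symm.trans hcard)

/-! ### Consequences of the Leinster equation modulo p. -/

section Leinster

variable {G : Type*} [Group G] [Finite G] {p q n : ℕ}

lemma IsLeinster.exists_normal_card_eq (hp : p.Prime) (hq : q.Prime) (hn : n ≠ 0)
    (hcard : Nat.card G = p ^ n * q) (hG : IsLeinster G) :
    ∃ Q : Subgroup G, Q.Normal ∧ Nat.card Q = q ∧ q ≠ p := by
  by_contra! hno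
  have h1 : normalOrderSum G ≡ 1 [MOD p] := by
    rw [normalOrderSum_eq_sum]
    refine sum_card_modEq_one _ (by simp only [mem_normalSubgroups]; infer_instance) ?_
    intro N hN hne
    rw [mem_normalSubgroups] at hN
    by_contra hpN
    have h2 : Nat.card N ∣ q :=
      ((hp.coprime_iff_not_dvd.2 hpN).symm.pow_right n).dvd_of_dvd_mul_left
        (hcard ▸ Subgroup.card_subgroup_dvd_card N)
    rcases (Nat.dvd_prime hq).1 h2 with h3 | h3
    · exact hne (Subgroup.card_eq_one.1 h3)
    · exact hpN (by rw [h3, hno N hN h3])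
  have h2 : p ∣ normalOrderSum G := by
    rw [hG, hcard]
    exact ((dvd_pow_self p hn).mul_right q).mul_left 2
  exact hp.one_lt.ne' (Nat.dvd_one.1 ((h1.dvd_iff dvd_rfl).1 h2))

variable {Q : Subgroup G} [Q.Normal]

lemma IsLeinster.dvd_card_add_one (hp : p.Prime) (hQ : (Nat.card Q).Prime) (hn : n ≠ 0)
    (hcard : Nat.card G = p ^ n * Nat.card Q) (hG : IsLeinster G) : p ∣ Nat.card Q + 1 := by
  have h1 := normalOrderSum_modEq_one hp (card_quotient_of_card_eq hQ hcard)
  have h2 := normalOrderSumAvoiding_modEq_one hp hQ hcard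
  have h3 := (h1.mul_left (Nat.card Q)).add h2
  rw [← normalOrderSum_eq_quotient_add, hG, hcard, mul_one] at h3
  exact (h3.dvd_iff dvd_rfl).1 (((dvd_pow_self p hn).mul_right _).mul_left 2)

/-- The automorphism induced by y ∈ P has order dividing both pⁿ and q − 1. As p ∣ q + 1 and p is
odd, p ∤ q − 1, so P centralizes Q. -/
lemma normal_of_dvd_card_add_one (hp : p.Prime) (hp2 : p ≠ 2) (hQ : (Nat.card Q).Prime)
    (hdvd : p ∣ Nat.card Q + 1) {P : Subgroup G} (hc : Q.IsComplement' P)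
    (hP : Nat.card P = p ^ n) : P.Normal := by
  refine normal_of_isComplement'_of_forall_commute hc fun x hx y hy => ?_
  refine commute_of_conjNormal_eq_one (orderOf_eq_one_iff.1 ?_) hx
  have h1 := orderOf_conjNormal_dvd hQ y
  have h2 : orderOf (MulAut.conjNormal y : MulAut Q) ∣ p ^ n :=
    (orderOf_map_dvd _ y).trans (hP ▸ P.orderOf_dvd_natCard hy)
  refine Nat.Coprime.eq_one_of_dvd (Nat.Coprime.coprime_dvd_left h2 (Nat.Coprime.pow_left n ?_)) h1
  rw [hp.coprime_iff_not_dvd]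
  intro h
  have h3 : p ∣ (Nat.card Q + 1) - (Nat.card Q - 1) := Nat.dvd_sub hdvd h
  have h4 : (Nat.card Q + 1) - (Nat.card Q - 1) = 2 := by have := hQ.one_lt; omega
  rw [h4] at h3
  exact hp2 ((Nat.prime_dvd_prime_iff_eq hp Nat.prime_two).1 h3)

end Leinster

/-- As s is prime to p, equality would give q + 1 = p³c and cs = 2q, with c prime to q, so c ∣ 2.
Parity excludes c = 1, and c = 2 gives s = q, hence p ∣ 2. -/
lemma mul_add_ne_of_modEq_one {p q s : ℕ} (hp : p.Prime) (hp2 : p ≠ 2) (hq : q.Prime)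
    (hs : s ≡ 1 [MOD p]) : q * s + s ≠ 2 * (p ^ 3 * q) := by
  intro h
  have hps : Nat.Coprime p s := by
    rw [hp.coprime_iff_not_dvd]
    intro hd
    exact hp.one_lt.ne' (Nat.dvd_one.1 ((hs.dvd_iff dvd_rfl).1 hd))
  have h1 : p ^ 3 ∣ q + 1 :=
    (Nat.Coprime.pow_left 3 hps).dvd_of_dvd_mul_right (n := s)
      ⟨2 * q, by linarith⟩
  obtain ⟨c, hc⟩ := h1
  have hp3 : 0 < p ^ 3 := pow_pos hp.pos 3
  have h2 : c * s = 2 * q := by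
    apply Nat.eq_of_mul_eq_mul_left hp3
    calc p ^ 3 * (c * s) = (p ^ 3 * c) * s := by ring
      _ = q * s + s := by rw [← hc]; ring
      _ = _ := by rw [h]; ring
  have hcq : Nat.Coprime c q :=
    Nat.Coprime.coprime_dvd_left (Dvd.intro_left _ hc.symm) (by simp)
  have h3 : c ∣ 2 := hcq.dvd_of_dvd_mul_right (h2 ▸ Dvd.intro _ rfl)
  have hodd : Odd (p ^ 3) := (hp.odd_of_ne_two hp2).pow
  rcases (Nat.dvd_prime Nat.prime_two).1 h3 with rfl | rfl
  · rw [mul_one] at hc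
    have hq2 : q = 2 := by
      rcases hq.eq_two_or_odd' with h | h
      · exact h
      · exact absurd (hc ▸ hodd) (by simpa [Nat.even_add_one] using h)
    have : 2 ^ 3 ≤ p ^ 3 := Nat.pow_le_pow_left hp.two_le 3
    omega
  · have hsq : s = q := by omega
    subst hsq
    have h4 : p ∣ s + 1 := hc ▸ (dvd_pow_self p three_ne_zero).mul_right 2
    have h5 : s + 1 ≡ 1 + 1 [MOD p] := hs.add_right 1
    exact hp2 ((Nat.prime_dvd_prime_iff_eq hp Nat.prime_two).1 ((h5.dvd_iff dvd_rfl).1 h4))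

/-! ### Groups of order 8 and cyclic subgroups of order 8. -/

lemma Subgroup.eq_of_le_zpowers_of_orderOf_eq_eight {G : Type*} [Group G] [Finite G] {g : G}
    (hg : orderOf g = 8) {N : Subgroup G} (hN : N ≤ zpowers g) :
    N = ⊥ ∨ N = zpowers (g ^ 4) ∨ N = zpowers (g ^ 2) ∨ N = zpowers g := by
  have key : ∀ d k : ℕ, Nat.gcd 8 (d * k) = Nat.gcd 8 d →
      zpowers (g ^ (d * k)) = zpowers (g ^ d) := by
    intro d k h
    refine eq_of_le_of_card_ge (zpowers_le.2 ?_) ?_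
    · rw [pow_mul]
      exact pow_mem (mem_zpowers _) k
    · rw [Nat.card_zpowers, Nat.card_zpowers, orderOf_pow, orderOf_pow, hg, h]
  obtain ⟨h, rfl⟩ : ∃ h, zpowers h = N := by
    refine (N.isCyclic_iff_exists_zpowers_eq_top).1 ?_
    exact isCyclic_of_injective (inclusion hN) (inclusion_injective hN)
  obtain ⟨m, rfl⟩ := mem_powers_iff_mem_zpowers.2 (hN (mem_zpowers h))
  obtain ⟨m, hm, hgm⟩ : ∃ k < 8, g ^ m = g ^ k :=
    ⟨m % 8, Nat.mod_lt _ (by norm_num), by rw [← hg, pow_mod_orderOf]⟩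
  simp only [hgm]
  have h1 : ∀ k, Nat.gcd 8 k = 1 → zpowers (g ^ k) = zpowers g := fun k hk => by
    simpa using key 1 k (by simpa using hk)
  interval_cases m
  · simp
  · simp
  · simp
  · simp [h1 3 (by norm_num)]
  · simp
  · simp [h1 5 (by norm_num)]
  · simp [key 2 3 (by norm_num)]
  · simp [h1 7 (by norm_num)]

/-- The subgroups of a cyclic group of order `8` form a chain, with orders `1, 2, 4, 8`. -/
lemma Subgroup.sum_chain_of_orderOf_eq_eight {G : Type*} [Group G] [Finite G]
    [DecidableEq (Subgroup G)] {g : G} (hg : orderOf g = 8) (f : Subgroup G → ℕ) :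
    ∑ N ∈ {⊥, zpowers (g ^ 4), zpowers (g ^ 2), zpowers g}, f N =
      f ⊥ + (f (zpowers (g ^ 4)) + (f (zpowers (g ^ 2)) + f (zpowers g))) := by
  have h1 : Nat.card (zpowers g) = 8 := by rw [Nat.card_zpowers, hg]
  have h2 : Nat.card (zpowers (g ^ 2)) = 4 := by rw [Nat.card_zpowers, orderOf_pow, hg]; norm_num
  have h4 : Nat.card (zpowers (g ^ 4)) = 2 := by rw [Nat.card_zpowers, orderOf_pow, hg]; norm_num
  have h0 : Nat.card (⊥ : Subgroup G) = 1 := Subgroup.card_bot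
  have ne : ∀ {A B : Subgroup G}, Nat.card A ≠ Nat.card B → A ≠ B := fun h e => h (e ▸ rfl)
  rw [Finset.sum_insert, Finset.sum_insert, Finset.sum_insert, Finset.sum_singleton]
  · rw [Finset.mem_singleton]
    exact ne (by rw [h1, h2]; norm_num)
  · simp only [Finset.mem_insert, Finset.mem_singleton, not_or]
    exact ⟨ne (by rw [h4, h2]; norm_num), ne (by rw [h4, h1]; norm_num)⟩
  · simp only [Finset.mem_insert, Finset.mem_singleton, not_or]
    exact ⟨ne (by rw [h0, h4]; norm_num), ne (by rw [h0, h2]; norm_num),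
      ne (by rw [h0, h1]; norm_num)⟩

lemma normalOrderSum_of_isCyclic_of_card_eq_eight {C : Type*} [Group C] [Finite C] [IsCyclic C]
    (hC : Nat.card C = 8) : normalOrderSum C = 15 := by
  classical
  obtain ⟨g, hg⟩ := IsCyclic.exists_ofOrder_eq_natCard (α := C)
  have htop : Subgroup.zpowers g = ⊤ :=
    Subgroup.eq_top_of_card_eq _ (by rw [Nat.card_zpowers, hg])
  rw [hC] at hg
  have hcomm := IsCyclic.isMulCommutative (α := C)
  have : normalSubgroups C =
      {⊥, Subgroup.zpowers (g ^ 4), Subgroup.zpowers (g ^ 2), Subgroup.zpowers g} := by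
    ext N
    rw [mem_normalSubgroups]
    constructor
    · intro _
      simpa using Subgroup.eq_of_le_zpowers_of_orderOf_eq_eight hg (htop ▸ le_top : N ≤ _)
    · intro _
      exact ⟨fun y hy x => by rw [mul_comm' x y, mul_inv_cancel_right]; exact hy⟩
  rw [normalOrderSum_eq_sum, this, Subgroup.sum_chain_of_orderOf_eq_eight hg, Subgroup.card_bot]
  simp only [Nat.card_zpowers, orderOf_pow, hg]
  norm_num

/-- Two subgroups of order 4 would already contribute 8 + 4 + 4 = 16. With only one, any element
outside it must generate. -/
lemma isCyclic_of_normalOrderSum_lt_sixteen {C : Type*} [Group C] [Finite C]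
    (hC : Nat.card C = 8) (h : normalOrderSum C < 16) : IsCyclic C := by
  classical
  have hnorm : ∀ M : Subgroup C, Nat.card M = 4 → M.Normal := by
    intro M hM
    refine Subgroup.normal_of_index_eq_two ?_
    have := M.card_mul_index
    rw [hM, hC] at this
    omega
  have huniq : ∀ M M' : Subgroup C, Nat.card M = 4 → Nat.card M' = 4 → M = M' := by
    intro M M' hM hM'
    by_contra hne
    have hsub : ({⊤, M, M'} : Finset (Subgroup C)) ⊆ normalSubgroups C := by
      intro N hN
      simp only [Finset.mem_insert, Finset.mem_singleton] at hN
      rw [mem_normalSubgroups]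
      rcases hN with rfl | rfl | rfl
      · infer_instance
      · exact hnorm _ hM
      · exact hnorm _ hM'
    have hle := Finset.sum_le_sum_of_subset (f := fun N : Subgroup C => Nat.card N) hsub
    have htop : ∀ N : Subgroup C, Nat.card N = 4 → ⊤ ≠ N := by
      rintro N hN rfl
      rw [Subgroup.card_top, hC] at hN
      omega
    rw [← normalOrderSum_eq_sum, Finset.sum_insert, Finset.sum_pair hne, Subgroup.card_top,
      hC, hM, hM'] at hle
    · omega
    · simp [htop M hM, htop M' hM']
  have : Fact (Nat.Prime 2) := ⟨Nat.prime_two⟩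
  obtain ⟨M, hM⟩ := Sylow.exists_subgroup_card_pow_prime (G := C) 2 (n := 2) (by rw [hC]; norm_num)
  obtain ⟨g, hg⟩ : ∃ g, g ∉ M := by
    by_contra! hall
    have := Subgroup.card_top (G := C)
    rw [← (Subgroup.eq_top_iff' M).2 hall, hM, hC] at this
    omega
  refine isCyclic_of_orderOf_eq_card g ?_
  have hd : orderOf g ∣ 2 ^ 3 := by
    have := orderOf_dvd_natCard g
    rwa [hC] at this
  obtain ⟨k, hk, hgk⟩ := (Nat.dvd_prime_pow Nat.prime_two).1 hd
  rcases hk.lt_or_eq with hk | rfl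
  -- An element of order at most 4 lies in a subgroup of order 4, hence in M.
  · obtain ⟨K, hK, hle⟩ := Sylow.exists_subgroup_card_pow_prime_le (G := C) 2 (m := 2)
      (by rw [hC]; norm_num) (Subgroup.zpowers g) (by rw [Nat.card_zpowers, hgk]) (by omega)
    rw [huniq K M (by simpa using hK) (by simpa using hM)] at hle
    exact absurd (hle (Subgroup.mem_zpowers g)) hg
  · rw [hgk, hC]; norm_num

/-- A group of order `56` with a normal subgroup of order `7` inverted by a generator of a cyclic
complement is `C_7 ⋊ C_8`. -/
lemma nonempty_mulEquiv_c7SemidirectC8 {G : Type*} [Group G] {Q P : Subgroup G} [Q.Normal]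
    (hc : Q.IsComplement' P) (hQ : Nat.card Q = 7) (hP : Nat.card P = 8) {g : G}
    (hg : Subgroup.zpowers g = P) (hinv : ∀ x ∈ Q, g * x * g⁻¹ = x⁻¹) :
    Nonempty (G ≃* C7SemidirectC8) := by
  have : Fact (Nat.Prime 7) := ⟨by norm_num⟩
  have hQc : IsCyclic Q := isCyclic_of_prime_card hQ
  have hgP : g ∈ P := hg ▸ Subgroup.mem_zpowers g
  have hgen : ∀ x : P, x ∈ Subgroup.zpowers (⟨g, hgP⟩ : P) := by
    rintro ⟨x, hx⟩
    obtain ⟨k, rfl⟩ := Subgroup.mem_zpowers_iff.1 (hg ▸ hx : x ∈ Subgroup.zpowers g)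
    exact Subgroup.mem_zpowers_iff.2 ⟨k, rfl⟩
  let e7 : Cyc 7 ≃* Q := mulEquivOfPrimeCardEq (p := 7) (by simp) hQ
  let e8 : Cyc 8 ≃* P := zmodMulEquivOfGenerator hgen hP
  have he8 : ∀ k : Cyc 8, (e8 k : G) = g ^ (ZMod.val (Multiplicative.toAdd k)) := by
    intro k
    have h1 := zmodMulEquivOfGenerator_apply_ofAdd_intCast hgen hP
      (ZMod.val (Multiplicative.toAdd k) : ℕ)
    rw [Int.cast_natCast, ZMod.natCast_zmod_val, ofAdd_toAdd] at h1
    rw [show e8 k = _ from h1, zpow_natCast, Subgroup.coe_pow]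
  have hpow : ∀ (m : ℕ) (y : Cyc 7), (e7 (((MulEquiv.inv (Cyc 7) : MulAut (Cyc 7)) ^ m) y) : G) =
      g ^ m * e7 y * (g ^ m)⁻¹ := by
    intro m
    induction m with
    | zero => intro y; simp
    | succ m ih =>
      intro y
      rw [pow_succ, MulAut.mul_apply, ih, MulEquiv.inv_apply, map_inv, Subgroup.coe_inv,
        ← hinv _ (e7 y).2, pow_succ]
      group
  refine ⟨(SemidirectProduct.mulEquivSubgroup hc).symm.trans
    (SemidirectProduct.congr e7 e8 fun k => ?_).symm⟩
  ext y
  have h1 := hpow (ZMod.val (Multiplicative.toAdd k)) y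
  rw [← he8 k] at h1
  exact h1

/-- The normal subgroups of `G` avoiding `Q` lie in the complement `P`; when `P` is cyclic of
order `8` and not normal, they form an initial segment of its subgroup chain. -/
lemma normalOrderSumAvoiding_eq_of_orderOf_eq_eight {G : Type*} [Group G] [Finite G]
    {Q : Subgroup G} (hQ : (Nat.card Q).Prime) (hQ2 : Nat.card Q ≠ 2)
    (hcard : Nat.card G = 2 ^ 3 * Nat.card Q) {g : G} (hg : orderOf g = 8)
    (hgn : ¬ (Subgroup.zpowers g).Normal) :
    open Classical in normalOrderSumAvoiding Q =
      1 + ((if (Subgroup.zpowers (g ^ 4)).Normal then 2 else 0) +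
        (if (Subgroup.zpowers (g ^ 2)).Normal then 4 else 0)) := by
  classical
  have hP : Nat.card (Subgroup.zpowers g) = 2 ^ 3 := by rw [Nat.card_zpowers, hg]; norm_num
  have hset : (normalSubgroups G).filter (fun N => ¬ Q ≤ N) =
      ({⊥, Subgroup.zpowers (g ^ 4), Subgroup.zpowers (g ^ 2), Subgroup.zpowers g} :
        Finset (Subgroup G)).filter (fun N => N.Normal) := by
    ext N
    rw [Finset.mem_filter, Finset.mem_filter, mem_normalSubgroups]
    constructor
    · rintro ⟨hN, hle⟩
      refine ⟨?_, hN⟩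
      simpa using Subgroup.eq_of_le_zpowers_of_orderOf_eq_eight hg
        (le_of_normal_of_card_dvd Nat.prime_two hQ hQ2 hcard hP hN
          (card_dvd_of_not_le hQ hcard hN hle))
    · rintro ⟨hmem, hN⟩
      refine ⟨hN, Subgroup.not_le_of_card_dvd_prime_pow Nat.prime_two hQ hQ2 (n := 3) ?_⟩
      rw [← hP]
      refine Subgroup.card_dvd_of_le ?_
      simp only [Finset.mem_insert, Finset.mem_singleton] at hmem
      rcases hmem with rfl | rfl | rfl | rfl
      · exact bot_le
      · exact Subgroup.zpowers_le.2 (pow_mem (Subgroup.mem_zpowers g) 4)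
      · exact Subgroup.zpowers_le.2 (pow_mem (Subgroup.mem_zpowers g) 2)
      · exact le_rfl
  rw [normalOrderSumAvoiding, hset, Finset.sum_filter,
    Subgroup.sum_chain_of_orderOf_eq_eight hg, if_neg hgn,
    if_pos (inferInstance : (⊥ : Subgroup G).Normal), Subgroup.card_bot]
  simp only [Nat.card_zpowers, orderOf_pow, hg]
  norm_num

/-- A power of `g` centralizing `Q` generates a normal subgroup, when `⟨g⟩` is a complement. -/
lemma normal_zpowers_pow_of_commute {G : Type*} [Group G] {Q : Subgroup G} {g : G}
    (hc : Q.IsComplement' (Subgroup.zpowers g)) {k : ℕ} (h : ∀ x ∈ Q, Commute x (g ^ k)) :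
    (Subgroup.zpowers (g ^ k)).Normal := by
  refine normal_of_isComplement'_of_commute hc ?_ ?_
  · intro x hx y hy
    obtain ⟨m, rfl⟩ := Subgroup.mem_zpowers_iff.1 hy
    exact (h x hx).zpow_right m
  · intro x hx y hy
    obtain ⟨l, rfl⟩ := Subgroup.mem_zpowers_iff.1 hx
    obtain ⟨m, rfl⟩ := Subgroup.mem_zpowers_iff.1 hy
    have : Commute (g ^ l) ((g ^ k) ^ m) := 
      (((Commute.refl g).pow_right k).zpow_right m).zpow_left l
    rwa [this.eq, mul_inv_cancel_right]

lemma commute_of_normal_zpowers_pow {G : Type*} [Group G] {Q : Subgroup G} [hQ : Q.Normal] {g : G}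
    (hc : Q.IsComplement' (Subgroup.zpowers g)) {k : ℕ}
    (h : (Subgroup.zpowers (g ^ k)).Normal) : ∀ x ∈ Q, Commute x (g ^ k) := fun x hx =>
  Subgroup.commute_of_normal_of_disjoint Q _ hQ h
    (hc.disjoint.mono_right (Subgroup.zpowers_le.2 (pow_mem (Subgroup.mem_zpowers g) k)))
    x _ hx (Subgroup.mem_zpowers _)

/-! ### The classification. -/

theorem proposition3p8 {G : Type*} [Group G] [Finite G] (p q : ℕ) (hp : p.Prime) (hq : q.Prime)
    (hcard : Nat.card G = p ^ 3 * q) (hG : IsLeinster G) :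
    Nonempty (G ≃* C7SemidirectC8) := by
  have : Fact p.Prime := ⟨hp⟩
  obtain ⟨Q, hQn, rfl, hQp⟩ := hG.exists_normal_card_eq hp hq three_ne_zero hcard
  obtain ⟨P, hP⟩ := Sylow.exists_subgroup_card_pow_prime (G := G) p (n := 3)
    (hcard ▸ Dvd.intro _ rfl)
  have hc := isComplement'_of_card_prime_pow hp hq hQp hcard hP
  have hquot := card_quotient_of_card_eq hq hcard
  have hsum : Nat.card Q * normalOrderSum (G ⧸ Q) + normalOrderSumAvoiding Q =
      2 * (p ^ 3 * Nat.card Q) := by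
    rw [← normalOrderSum_eq_quotient_add, hG, hcard]
  obtain rfl : p = 2 := by
    by_contra hp2
    have hPn := normal_of_dvd_card_add_one hp hp2 hq
      (hG.dvd_card_add_one hp hq three_ne_zero hcard) hc hP
    rw [normalOrderSumAvoiding_eq_of_normal hp hq hQp hcard hP hPn] at hsum
    exact mul_add_ne_of_modEq_one hp hp2 hq (normalOrderSum_modEq_one hp hquot) hsum
  have hSpos : 0 < normalOrderSumAvoiding Q := by
    by_contra h0
    have h1 := normalOrderSumAvoiding_modEq_one hp hq hcard
    rw [Nat.eq_zero_of_not_pos h0] at h1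
    exact absurd h1 (by decide)
  have hquot8 : Nat.card (G ⧸ Q) = 8 := by rw [hquot]; norm_num
  have hcyc : IsCyclic (G ⧸ Q) := by
    refine isCyclic_of_normalOrderSum_lt_sixteen hquot8 ?_
    by_contra! h16
    have := Nat.mul_le_mul_left (Nat.card Q) h16
    omega
  have hS : normalOrderSumAvoiding Q = Nat.card Q := by
    rw [normalOrderSum_of_isCyclic_of_card_eq_eight hquot8] at hsum
    omega
  have hPn : ¬ P.Normal := by
    intro hPn
    rw [normalOrderSumAvoiding_eq_of_normal hp hq hQp hcard hP hPn,
      normalOrderSum_of_isCyclic_of_card_eq_eight hquot8] at hS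
    -- Here q = σ(G/Q) = 15, which is not prime.
    rw [← hS] at hq
    exact absurd hq (by norm_num)
  have hPcyc : IsCyclic P :=
    isCyclic_of_injective hc.mulEquivQuotient.toMonoidHom hc.mulEquivQuotient.injective
  obtain ⟨g, rfl⟩ := P.isCyclic_iff_exists_zpowers_eq_top.1 hPcyc
  have hg : orderOf g = 8 := by rw [← Nat.card_zpowers, hP]; norm_num
  have hchain : (Subgroup.zpowers (g ^ 2)).Normal → (Subgroup.zpowers (g ^ 4)).Normal := by
    intro h
    refine normal_zpowers_pow_of_commute hc fun x hx => ?_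
    rw [show g ^ 4 = (g ^ 2) ^ 2 by rw [← pow_mul]]
    exact (commute_of_normal_zpowers_pow hc h x hx).pow_right 2
  -- For q = 3, Aut(Q) has order 2, so g² acts trivially.
  have hthree : Nat.card Q = 3 → (Subgroup.zpowers (g ^ 2)).Normal := by
    intro h3
    refine normal_zpowers_pow_of_commute hc fun x hx => commute_of_conjNormal_eq_one ?_ hx
    rw [map_pow]
    refine orderOf_dvd_iff_pow_eq_one.1 ?_
    simpa [h3] using orderOf_conjNormal_dvd hq g
  rw [normalOrderSumAvoiding_eq_of_orderOf_eq_eight hq hQp hcard hg hPn] at hS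
  -- Otherwise q is 1 or 1 + 2 = 3, and `hthree` excludes 3.
  have h2 : (Subgroup.zpowers (g ^ 2)).Normal := by
    by_contra h2
    rw [if_neg h2] at hS
    split_ifs at hS
    · exact h2 (hthree hS.symm)
    · exact hq.ne_one hS.symm
  -- Now q = 1 + 2 + 4 = 7.
  rw [if_pos h2, if_pos (hchain h2)] at hS
  rcases forall_commute_or_forall_conj_eq_inv hq (commute_of_normal_zpowers_pow hc h2) with h | h
  · refine absurd ?_ hPn
    simpa using normal_zpowers_pow_of_commute (k := 1) hc (by simpa using h)
  · exact nonempty_mulEquiv_c7SemidirectC8 hc hS.symm (by rw [hP]; norm_num) rfl h
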